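/- Let $R$ be a ring with unit $1\neq 0$ (not necessarily commutative), equipped with the discrete norm $|x|=0$ if $x=0$ and $|x|=1$ if $x\ne 0$. Let $n\ge 2$ and let $\Gamma$ be a group of type $\mathrm{FP}_n(R)$, i.e. the trivial left $R\Gamma$-module $R$ has a projective resolution whose modules in degrees $\le n$ are finitely generated. Let $P_*\to R$ be any projective $R\Gamma$-resolution of the trivial module $R$ such that $P_{n-1}$ and $P_n$ are finitely generated free $R\Gamma$-modules equipped with chosen finite bases. For a free $R\Gamma$-module with finite basis $B$ put $\bigl\|\sum_{\gamma\in\Gamma,\,b\in B} a_{\gamma b}\,\gamma b\bigr\|=\sum_{\gamma,b}|a_{\gamma b}|$ (the cardinality of the support). For $l\in\mathbb{R}_{\ge 0}$ let $$\mathrm{dFV}^n_{R,\Gamma}(l)\;=\;\sup_{\substack{c\in P_{n-1}\\ \partial c=0,\ \|c\|\le l}}\ \ \inf_{\substack{b\in P_n\\ \partial b=c}}\ \|b\|\ \in\ \mathbb{R}_{\ge 0}\cup\{\infty\}$$ be the discrete filling function of $\Gamma$ computed from $P_*$. Then $\mathrm{dFV}^n_{R,\Gamma}(l)<\infty$ for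 every $l\in\mathbb{R}_{\ge 0}$. -/

import Mathlib

open CategoryTheory
open scoped NNReal ENNReal

universe u v

namespace HomologicalFilling

noncomputable section

/-- A norm on a (not necessarily commutative) ring. Symmetry under negation is not required. -/
structure NormOnRing (R : Type u) [Ring R] where
  toFun : R → ℝ≥0
  eq_zero_iff : ∀ x, toFun x = 0 ↔ x = 0
  add_le : ∀ x y, toFun (x + y) ≤ toFun x + toFun y
  mul_le : ∀ x y, toFun (x * y) ≤ toFun x * toFun y

open Classical in
/-- The discrete norm: `0` at `0` and `1` elsewhere. -/
def discreteNorm (R : Type u) [Ring R] : NormOnRing R where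
  toFun x := if x = 0 then 0 else 1
  eq_zero_iff x := by by_cases h : x = 0 <;> simp [h]
  add_le x y := by
    by_cases hx : x = 0
    · simp [hx]
    · simp only [hx, if_false]
      split_ifs <;> simp
  mul_le x y := by
    by_cases hx : x = 0
    · simp [hx]
    · by_cases hy : y = 0
      · simp [hy]
      · simp only [hx, hy, if_false]
        split_ifs <;> simp

/-- The augmentation `RΓ → R`, sending `∑ a_γ γ` to `∑ a_γ`. -/
def augmentation (R : Type u) (Γ : Type v) [Ring R] [Group Γ] : MonoidAlgebra R Γ →+* R :=
  MonoidAlgebra.liftNCRingHom (RingHom.id R) (1 : Γ →* R) fun _ _ => Commute.one_right _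

/-- The trivial left `RΓ`-module `R`: a group ring element acts through its augmentation.
(The universe lift places it in the same universe as `RΓ`.) -/
def trivialModule (R : Type u) (Γ : Type v) [Ring R] [Group Γ] :
    ModuleCat.{max u v} (MonoidAlgebra R Γ) :=
  letI : Module (MonoidAlgebra R Γ) (ULift.{v} R) := Module.compHom _ (augmentation R Γ)
  ModuleCat.of (MonoidAlgebra R Γ) (ULift.{v} R)

/-- `Γ` is of type `FP_n(R)`: there is a projective resolution of the trivial `RΓ`-module `R`
whose modules in degrees `≤ n` are finitely generated. -/
def IsTypeFP (R : Type u) (Γ : Type v) [Ring R] [Group Γ] (n : ℕ) : Prop :=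
  ∃ P : ProjectiveResolution (trivialModule R Γ),
    ∀ i ≤ n, Module.Finite (MonoidAlgebra R Γ) (P.complex.X i)

/-- An `n`-admissible resolution: a projective resolution of the trivial `RΓ`-module `R`
whose modules in degrees `n` and `n + 1` are finitely generated free,
equipped with a choice of (finite) bases. -/
structure AdmissibleResolution (R : Type u) (Γ : Type v) [Ring R] [Group Γ] (n : ℕ) where
  res : ProjectiveResolution (trivialModule R Γ)
  rank : ℕ
  basis : Module.Basis (Fin rank) (MonoidAlgebra R Γ) (res.complex.X n)
  rankSucc : ℕ
  basisSucc : Module.Basis (Fin rankSucc) (MonoidAlgebra R Γ) (res.complex.X (n + 1))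

/-- The `ℓ¹`-norm on a free `RΓ`-module `M` with finite basis `B`, seen as a free `R`-module with
basis `ΓB`: an element `∑_{b, γ} a_{γ b} γ b` has norm `∑_{b, γ} |a_{γ b}|`. -/
def l1Norm {R : Type u} {Γ : Type v} [Ring R] [Group Γ] (N : NormOnRing R)
    {M : Type*} [AddCommGroup M] [Module (MonoidAlgebra R Γ) M] {r : ℕ}
    (B : Module.Basis (Fin r) (MonoidAlgebra R Γ) M) (x : M) : ℝ≥0 :=
  ∑ i : Fin r, ∑ γ ∈ (B.repr x i).coeff.support, N.toFun ((B.repr x i).coeff γ)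

/-- Cycles of a resolution: the kernel of the differential in positive degrees, and the
kernel of the augmentation of the resolution in degree `0`. -/
def IsCycle {R : Type u} {Γ : Type v} [Ring R] [Group Γ]
    (P : ProjectiveResolution (trivialModule R Γ)) : (n : ℕ) → P.complex.X n → Prop
  | 0, c => (P.π.f 0).hom c = 0
  | m + 1, c => (P.complex.d (m + 1) m).hom c = 0

/-- The filling volume of an `n`-chain `c` (`∞` if `c` has no filling). -/
def fillingVolume {R : Type u} {Γ : Type v} [Ring R] [Group Γ] (N : NormOnRing R) {n : ℕ}
    (P : AdmissibleResolution R Γ n) (c : P.res.complex.X n) : ℝ≥0∞ :=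
  ⨅ (b : P.res.complex.X (n + 1)) (_ : (P.res.complex.d (n + 1) n).hom b = c),
    (l1Norm N P.basisSucc b : ℝ≥0∞)

/-- The `n`-th homological filling function, computed from the `n`-admissible resolution `P`:
the supremum of the filling volumes of all `n`-cycles of norm at most `l`. -/
def fillingFunction {R : Type u} {Γ : Type v} [Ring R] [Group Γ] (N : NormOnRing R) {n : ℕ}
    (P : AdmissibleResolution R Γ n) (l : ℝ≥0) : ℝ≥0∞ :=
  ⨆ (c : P.res.complex.X n) (_ : IsCycle P.res n c) (_ : l1Norm N P.basis c ≤ l),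
    fillingVolume N P c

/-- The discrete filling function `dFV^n` for `n ≥ 1`. By convention its index is shifted by one:
it measures fillings of `(n - 1)`-cycles by `n`-chains, for the discrete norm on `R`. -/
def dFV {R : Type u} {Γ : Type v} [Ring R] [Group Γ] (n : ℕ)
    (P : AdmissibleResolution R Γ (n - 1)) (l : ℝ≥0) : ℝ≥0∞ :=
  fillingFunction (discreteNorm R) P l

end

end HomologicalFilling

/-!
Two observations bound the fillings of the cycles in `P_{m + 1}` of a given size.

All modules of the resolution are projective over the coefficient ring `R`, and so is the trivial
module, so the resolution splits over `R`: there is an `R`-linear (not `RΓ`-linear) map `h` with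
`∂ (h z) = z` for every cycle `z` in a positive degree (`exists_linear_filling`). Since `h` is
`R`-linear and multiplication by a scalar does not increase the discrete norm, `h` is bounded on the
chains supported in a fixed finite set, whatever their coefficients are (`exists_supportSize_le`).
No finiteness condition on `R` is needed for this.

The supports of cycles of size at most `l` are not contained in one finite set, even up to
translation. But the differential `∂ : P_{m + 1} → P_m`, followed by an embedding of the projective
module `P_m` into a free one, has a matrix with finitely many nonzero entries, each of finite
support. Hence `∂` only sees interactions between elements of `Γ` which are adjacent for some
finite `E ⊆ Γ`, and the restriction of a cycle to a union of connected components of its support is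
again a cycle (`exists_adjacency`). A cycle of size at most `l` thus is a sum of at most `l` cycles,
each a translate of a cycle supported in `E ^ l` (`exists_closed_subset_near`), and each of these
has a filling of bounded size (`exists_filling_bound`).
-/

namespace HomologicalFilling

section Contraction

/-! ### Fillings that are linear over the coefficient ring -/

theorem projective_of_groupRing_projective {R Γ M : Type*} [Ring R] [Group Γ] [AddCommGroup M]
    [Module R M] [Module (MonoidAlgebra R Γ) M] [IsScalarTower R (MonoidAlgebra R Γ) M]
    [hM : Module.Projective (MonoidAlgebra R Γ) M] : Module.Projective R M := by
  obtain ⟨s, hs⟩ := Module.projective_def'.1 hM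
  have : Module.Free R (MonoidAlgebra R Γ) := Module.Free.of_basis (MonoidAlgebra.basis Γ R)
  exact Module.Projective.of_split (s.restrictScalars R)
    ((Finsupp.linearCombination (MonoidAlgebra R Γ) (id : M → M)).restrictScalars R)
    (LinearMap.ext fun x => LinearMap.congr_fun hs x)

/-- One step of the construction of a contraction of an exact complex of projectives: a partial
section `s` of `g`, in the sense that `g ∘ s ∘ g = g`, yields one of the preceding map `f`,
since `1 - s ∘ g` is a projection onto `ker g = range f` that lifts along `f`. -/
theorem exists_partial_section_of_exact {R A B C : Type*} [Ring R] [AddCommGroup A] [AddCommGroup B]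
    [AddCommGroup C] [Module R A] [Module R B] [Module R C] [Module.Projective R B]
    (f : A →ₗ[R] B) (g : B →ₗ[R] C) (hfg : Function.Exact f g)
    (s : C →ₗ[R] B) (hs : ∀ x, g (s (g x)) = g x) :
    ∃ t : B →ₗ[R] A, ∀ x, f (t (f x)) = f x := by
  let p : B →ₗ[R] LinearMap.range f :=
    (LinearMap.id - s ∘ₗ g).codRestrict (LinearMap.range f) fun x =>
      (hfg _).1 (by simp [hs])
  obtain ⟨t, ht⟩ := Module.projective_lifting_property f.rangeRestrict p f.surjective_rangeRestrict
  refine ⟨t, fun x => ?_⟩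
  refine (congrArg Subtype.val (LinearMap.congr_fun ht (f x))).trans ?_
  change f x - s (g (f x)) = f x
  rw [hfg.apply_apply_eq_zero, map_zero, sub_zero]

variable {R : Type u} {Γ : Type v} [Ring R] [Group Γ]

/-- The coefficient ring `R` acts on every `RΓ`-module through the inclusion `R → RΓ`. -/
noncomputable abbrev coefficientModule (M : ModuleCat.{max u v} (MonoidAlgebra R Γ)) : Module R M :=
  Module.compHom M (MonoidAlgebra.singleOneRingHom : R →+* MonoidAlgebra R Γ)

theorem isScalarTower_coefficientModule (M : ModuleCat.{max u v} (MonoidAlgebra R Γ)) :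
    letI := coefficientModule M
    IsScalarTower R (MonoidAlgebra R Γ) M := by
  let := coefficientModule M
  refine ⟨fun r x m => ?_⟩
  change (r • x) • m = (MonoidAlgebra.single 1 r : MonoidAlgebra R Γ) • x • m
  rw [smul_smul]
  congr 1
  ext g
  simp

theorem projective_trivialModule :
    letI := coefficientModule (trivialModule R Γ)
    Module.Projective R (trivialModule R Γ) := by
  let := coefficientModule (trivialModule R Γ)
  let e : R ≃ₗ[R] trivialModule R Γ :=
    { toFun := fun r => (ULift.up r : ULift.{v} R)
      invFun := fun x => ULift.down (x : ULift.{v} R)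
      left_inv := fun _ => rfl
      right_inv := fun _ => rfl
      map_add' := fun _ _ => rfl
      map_smul' := fun r x => by
        change (ULift.up (r * x) : ULift.{v} R) =
          ULift.up (augmentation R Γ (MonoidAlgebra.single 1 r) * x)
        simp [augmentation] }
  exact Module.Projective.of_equiv e

/-- The differentials of a projective resolution of the trivial module admit partial sections
which are linear over `R` (but in general not over `RΓ`). -/
theorem exists_linear_partial_section (P : ProjectiveResolution (trivialModule R Γ)) (k : ℕ) :
    letI := coefficientModule (R := R) (Γ := Γ)
    ∃ t : P.complex.X k →ₗ[R] P.complex.X (k + 1), ∀ x,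
      (P.complex.d (k + 1) k).hom (t ((P.complex.d (k + 1) k).hom x)) =
        (P.complex.d (k + 1) k).hom x := by
  let := coefficientModule (R := R) (Γ := Γ)
  have := isScalarTower_coefficientModule (R := R) (Γ := Γ)
  have : ∀ k, Module.Projective R (P.complex.X k) := fun k =>
    haveI := P.projective k
    projective_of_groupRing_projective (Γ := Γ)
  induction k with
  | zero =>
    have hsurj : Function.Surjective (P.π.f 0).hom :=
      (ModuleCat.epi_iff_surjective _).1 inferInstance
    have := projective_trivialModule (R := R) (Γ := Γ)
    have : Module.Projective R
        (((ChainComplex.single₀ (ModuleCat.{max u v} (MonoidAlgebra R Γ))).obj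
          (trivialModule R Γ)).X 0) :=
      Module.Projective.of_equiv
        ((HomologicalComplex.singleObjXSelf (ComplexShape.down ℕ) 0
          (trivialModule R Γ)).toLinearEquiv.symm.restrictScalars R)
    obtain ⟨s, hs⟩ := Module.projective_lifting_property
      ((P.π.f 0).hom.restrictScalars R) LinearMap.id hsurj
    exact exists_partial_section_of_exact ((P.complex.d 1 0).hom.restrictScalars R)
      ((P.π.f 0).hom.restrictScalars R)
      ((ShortComplex.ShortExact.moduleCat_exact_iff_function_exact _).1 P.exact₀) s
      (fun x => LinearMap.congr_fun hs _)
  | succ k ih =>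
    obtain ⟨s, hs⟩ := ih
    exact exists_partial_section_of_exact ((P.complex.d (k + 2) (k + 1)).hom.restrictScalars R)
      ((P.complex.d (k + 1) k).hom.restrictScalars R)
      ((ShortComplex.ShortExact.moduleCat_exact_iff_function_exact _).1 (P.exact_succ k)) s hs

/-- In positive degrees, cycles of a projective resolution of the trivial module can be filled in
an `R`-linear way. -/
theorem exists_linear_filling (P : ProjectiveResolution (trivialModule R Γ)) (m : ℕ) :
    ∃ h : P.complex.X (m + 1) →+ P.complex.X (m + 2),
      (∀ (r : R) x, h ((MonoidAlgebra.single 1 r : MonoidAlgebra R Γ) • x) =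
        (MonoidAlgebra.single 1 r : MonoidAlgebra R Γ) • h x) ∧
      ∀ z, (P.complex.d (m + 1) m).hom z = 0 → (P.complex.d (m + 2) (m + 1)).hom (h z) = z := by
  let := coefficientModule (R := R) (Γ := Γ)
  obtain ⟨t, ht⟩ := exists_linear_partial_section P (m + 1)
  refine ⟨t.toAddMonoidHom, fun r x => t.map_smul r x, fun z hz => ?_⟩
  obtain ⟨y, rfl⟩ :=
    ((ShortComplex.ShortExact.moduleCat_exact_iff_function_exact _).1 (P.exact_succ m) z).1 hz
  exact ht y

end Contraction

section Supports

/-! ### Supports and restrictions of chains -/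

open scoped Pointwise Classical

variable {R Γ M : Type*} [Ring R] [Group Γ] [AddCommGroup M] [Module (MonoidAlgebra R Γ) M]
  {r : ℕ} (B : Module.Basis (Fin r) (MonoidAlgebra R Γ) M)

/-- The norm of a chain for the discrete norm on `R`: the number of elements `γ b` with a nonzero
coefficient. -/
noncomputable def supportSize (x : M) : ℕ := ∑ i, (B.repr x i).coeff.support.card

/-- The set of all `γ` such that some `γ b`, with `b` in the basis, has a nonzero coefficient. -/
noncomputable def groupSupport (x : M) : Finset Γ := Finset.univ.biUnion fun i => (B.repr x i).coeff.support

theorem l1Norm_discreteNorm {R : Type u} {Γ : Type v} {M : Type*} [Ring R] [Group Γ]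
    [AddCommGroup M] [Module (MonoidAlgebra R Γ) M] {r : ℕ}
    (B : Module.Basis (Fin r) (MonoidAlgebra R Γ) M) (x : M) :
    l1Norm (discreteNorm R) B x = (supportSize B x : ℝ≥0) := by
  rw [l1Norm, supportSize, Nat.cast_sum]
  refine Finset.sum_congr rfl fun i _ => ?_
  rw [Finset.cast_card]
  refine Finset.sum_congr rfl fun γ hγ => ?_
  exact if_neg (Finsupp.mem_support_iff.1 hγ)

theorem card_groupSupport_le (x : M) : (groupSupport B x).card ≤ supportSize B x :=
  Finset.card_biUnion_le

theorem supportSize_zero : supportSize B 0 = 0 := by simp [supportSize]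

theorem supportSize_add_le (x y : M) :
    supportSize B (x + y) ≤ supportSize B x + supportSize B y := by
  rw [supportSize, supportSize, supportSize, ← Finset.sum_add_distrib]
  refine Finset.sum_le_sum fun i _ => ?_
  rw [map_add]
  exact (Finset.card_le_card Finsupp.support_add).trans (Finset.card_union_le _ _)

theorem supportSize_sum_le {ι : Type*} (s : Finset ι) (x : ι → M) :
    supportSize B (∑ i ∈ s, x i) ≤ ∑ i ∈ s, supportSize B (x i) :=
  Finset.le_sum_of_subadditive _ (supportSize_zero B).le (supportSize_add_le B) s x

theorem supportSize_single_smul_le (γ : Γ) (a : R) (x : M) :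
    supportSize B ((MonoidAlgebra.single γ a : MonoidAlgebra R Γ) • x) ≤ supportSize B x := by
  refine Finset.sum_le_sum fun i _ => ?_
  rw [map_smul, Finsupp.smul_apply, smul_eq_mul]
  exact (Finset.card_le_card (MonoidAlgebra.support_coeff_single_mul_subset _ _ _)).trans
    Finset.card_image_le

theorem mem_groupSupport {x : M} {γ : Γ} :
    γ ∈ groupSupport B x ↔ ∃ i, (B.repr x i).coeff γ ≠ 0 := by
  simp [groupSupport]

theorem coeff_eq_zero_of_notMem_groupSupport {x : M} {γ : Γ} (h : γ ∉ groupSupport B x)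
    (i : Fin r) : (B.repr x i).coeff γ = 0 := by
  by_contra hi
  exact h ((mem_groupSupport B).2 ⟨i, hi⟩)

theorem eq_zero_of_groupSupport_eq_empty {x : M} (h : groupSupport B x = ∅) : x = 0 := by
  apply B.repr.injective
  ext i γ
  simpa using coeff_eq_zero_of_notMem_groupSupport B (by simp [h]) i

/-- The restriction of a chain to a set `C` of group elements: only the coefficients of the `γ b`
with `γ ∈ C` are kept. -/
noncomputable def restrict (C : Finset Γ) (x : M) : M :=
  B.equivFun.symm fun i => MonoidAlgebra.ofCoeff ((B.repr x i).coeff.filter (· ∈ C))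

theorem coeff_repr_restrict (C : Finset Γ) (x : M) (i : Fin r) (γ : Γ) :
    (B.repr (restrict B C x) i).coeff γ = if γ ∈ C then (B.repr x i).coeff γ else 0 := by
  rw [← B.equivFun_apply, restrict, LinearEquiv.apply_symm_apply]
  simp [Finsupp.filter_apply]

theorem groupSupport_restrict_subset (C : Finset Γ) (x : M) :
    groupSupport B (restrict B C x) ⊆ C := by
  intro γ hγ
  obtain ⟨i, hi⟩ := (mem_groupSupport B).1 hγ
  by_contra h
  simp [coeff_repr_restrict, h] at hi

theorem groupSupport_sub_restrict_subset (C : Finset Γ) (x : M) :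
    groupSupport B (x - restrict B C x) ⊆ groupSupport B x \ C := by
  intro γ hγ
  obtain ⟨i, hi⟩ := (mem_groupSupport B).1 hγ
  rw [map_sub, Finsupp.sub_apply, MonoidAlgebra.coeff_sub, Finsupp.sub_apply,
    coeff_repr_restrict] at hi
  rw [Finset.mem_sdiff, mem_groupSupport]
  split_ifs at hi with h
  · simp at hi
  · exact ⟨⟨i, by simpa using hi⟩, h⟩

theorem groupSupport_single_smul_subset (γ : Γ) (x : M) (C : Finset Γ)
    (h : groupSupport B x ⊆ C) :
    groupSupport B ((MonoidAlgebra.single γ 1 : MonoidAlgebra R Γ) • x) ⊆ γ • C := by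
  intro δ hδ
  obtain ⟨i, hi⟩ := (mem_groupSupport B).1 hδ
  rw [map_smul, Finsupp.smul_apply, smul_eq_mul, MonoidAlgebra.coeff_single_mul_apply,
    one_mul] at hi
  rw [← Finset.inv_smul_mem_iff]
  exact h ((mem_groupSupport B).2 ⟨i, hi⟩)

theorem eq_sum_of_groupSupport_subset (x : M) (W : Finset Γ) (h : groupSupport B x ⊆ W) :
    x = ∑ i, ∑ γ ∈ W, (MonoidAlgebra.single 1 ((B.repr x i).coeff γ) : MonoidAlgebra R Γ) •
      (MonoidAlgebra.single γ 1 : MonoidAlgebra R Γ) • B i := by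
  conv_lhs => rw [← B.sum_repr x]
  refine Finset.sum_congr rfl fun i _ => ?_
  simp_rw [smul_smul, MonoidAlgebra.single_mul_single, one_mul, mul_one, ← Finset.sum_smul]
  congr 1
  conv_lhs => rw [← MonoidAlgebra.sum_coeff_single (B.repr x i)]
  refine Finsupp.sum_of_support_subset _ (fun γ hγ => h ?_) _ (by simp)
  exact (mem_groupSupport B).2 ⟨i, Finsupp.mem_support_iff.1 hγ⟩

end Supports

section Components

/-! ### Splitting cycles into components -/

open scoped Pointwise Classical

/-- Call `c` and `a` adjacent if `c⁻¹ * a ∈ E`. Every finite set `A` contains, with each of its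
points `γ`, a set that is closed under adjacency in `A` and lies within distance `|A|` of `γ`. -/
theorem exists_closed_subset_near {Γ : Type*} [Group Γ] {E A : Finset Γ} (hE : 1 ∈ E) {γ : Γ}
    (hγ : γ ∈ A) : ∃ C ⊆ A, γ ∈ C ∧ C ⊆ γ • E ^ A.card ∧
      ∀ c ∈ C, ∀ a ∈ A, c⁻¹ * a ∈ E → a ∈ C := by
  -- A maximal set `C` with `γ ∈ C ⊆ γ • E ^ |C|` is closed: otherwise it could be enlarged.
  let S := A.powerset.filter fun C => γ ∈ C ∧ C ⊆ γ • E ^ C.card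
  have hS : S.Nonempty := ⟨{γ}, by
    simp only [S, Finset.mem_filter, Finset.mem_powerset, Finset.singleton_subset_iff,
      Finset.mem_singleton, Finset.card_singleton, pow_one, true_and]
    exact ⟨hγ, by simpa [← Finset.inv_smul_mem_iff] using hE⟩⟩
  obtain ⟨C, hC, hmax⟩ := S.exists_max_image Finset.card hS
  simp only [S, Finset.mem_filter, Finset.mem_powerset] at hC hmax
  obtain ⟨hCA, hγC, hCE⟩ := hC
  refine ⟨C, hCA, hγC, hCE.trans (Finset.smul_finset_subset_smul_finset
    (Finset.pow_subset_pow_right hE (Finset.card_le_card hCA))), fun c hc a ha hca => ?_⟩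
  by_contra haC
  have := hmax (insert a C) ⟨Finset.insert_subset ha hCA, Finset.mem_insert_of_mem hγC, by
    rw [Finset.card_insert_of_notMem haC]
    refine Finset.insert_subset ?_ (hCE.trans (Finset.smul_finset_subset_smul_finset
      (Finset.pow_subset_pow_right hE (Nat.le_succ _))))
    rw [← Finset.inv_smul_mem_iff, pow_succ]
    have h := Finset.mul_mem_mul (Finset.inv_smul_mem_iff.2 (hCE hc)) hca
    simpa [mul_assoc] using h⟩
  rw [Finset.card_insert_of_notMem haC] at this
  omega

variable {R Γ M Q : Type*} [Ring R] [Group Γ] [AddCommGroup M] [Module (MonoidAlgebra R Γ) M]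
  [AddCommGroup Q] [Module (MonoidAlgebra R Γ) Q]
  {r : ℕ} (B : Module.Basis (Fin r) (MonoidAlgebra R Γ) M)

/-- If no translate `c • T` with `c ∈ C` meets a translate `a • T` with `a` in the remaining part
of the support of `x`, then multiplying the restriction of `x` to `C` by an element `y` supported
in `T` amounts to restricting `x * y` to `C * T`. -/
theorem coeff_restrict_mul (u x y : MonoidAlgebra R Γ) (A C T : Finset Γ)
    (hu : ∀ γ, u.coeff γ = if γ ∈ C then x.coeff γ else 0) (hx : x.coeff.support ⊆ A)
    (hy : y.coeff.support ⊆ T) (hC : ∀ c ∈ C, ∀ a ∈ A, c⁻¹ * a ∈ T * T⁻¹ → a ∈ C) (g : Γ) :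
    (u * y).coeff g = if g ∈ C * T then (x * y).coeff g else 0 := by
  have huA : u.coeff.support ⊆ A := fun γ hγ => hx <| by
    rw [Finsupp.mem_support_iff, hu] at hγ
    split_ifs at hγ
    · exact Finsupp.mem_support_iff.2 hγ
    · exact absurd rfl hγ
  have hT : ∀ γ, y.coeff γ ≠ 0 → γ ∈ T := fun γ h => hy (Finsupp.mem_support_iff.2 h)
  rw [MonoidAlgebra.coeff_mul_apply_left, MonoidAlgebra.coeff_mul_apply_left,
    Finsupp.sum_of_support_subset _ huA _ (by simp),
    Finsupp.sum_of_support_subset _ hx _ (by simp)]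
  split_ifs with hg
  · obtain ⟨c, hc, t, ht, rfl⟩ := Finset.mem_mul.1 hg
    refine Finset.sum_congr rfl fun a ha => ?_
    rw [hu]
    split_ifs with haC
    · rfl
    · suffices y.coeff (a⁻¹ * (c * t)) = 0 by simp [this]
      by_contra h
      refine haC (hC c hc a ha (Finset.mem_mul.2 ⟨t, ht, _, Finset.inv_mem_inv (hT _ h), ?_⟩))
      group
  · refine Finset.sum_eq_zero fun a _ => ?_
    rw [hu]
    split_ifs with haC
    · suffices y.coeff (a⁻¹ * g) = 0 by simp [this]
      by_contra h
      exact hg (Finset.mem_mul.2 ⟨a, haC, _, hT _ h, by group⟩)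
    · simp

/-- For a linear map `f` to a projective module there is a notion of adjacency in `Γ`, given by a
finite set `E`, for which elements of `ker f` split into pieces with non-adjacent supports. -/
theorem exists_adjacency [hQ : Module.Projective (MonoidAlgebra R Γ) Q]
    (f : M →ₗ[MonoidAlgebra R Γ] Q) :
    ∃ E : Finset Γ, 1 ∈ E ∧ ∀ (x : M) (C : Finset Γ), f x = 0 →
      (∀ c ∈ C, ∀ a ∈ groupSupport B x, c⁻¹ * a ∈ E → a ∈ C) → f (restrict B C x) = 0 := by
  -- `s` embeds `Q` into a free module, and `T` contains the supports of all entries of the matrix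
  -- of `s ∘ f`.
  obtain ⟨s, hs⟩ := Module.projective_def'.1 hQ
  let T : Finset Γ := Finset.univ.biUnion fun i =>
    (s (f (B i))).support.biUnion fun q => (s (f (B i)) q).coeff.support
  have hT : ∀ i q, (s (f (B i)) q).coeff.support ⊆ T := fun i q γ hγ => by
    have hq : s (f (B i)) q ≠ 0 := fun h => by simp [h] at hγ
    simp only [T, Finset.mem_biUnion]
    exact ⟨i, Finset.mem_univ _, q, Finsupp.mem_support_iff.2 hq, hγ⟩
  have hsf : ∀ x q, s (f x) q = ∑ i, B.repr x i * s (f (B i)) q := fun x q => by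
    conv_lhs => rw [← B.sum_repr x]
    simp only [map_sum, map_smul, Finsupp.finsetSum_apply, Finsupp.smul_apply, smul_eq_mul]
  refine ⟨insert 1 (T * T⁻¹), Finset.mem_insert_self _ _, fun x C hx hC => ?_⟩
  have hs_inj : Function.Injective s :=
    Function.LeftInverse.injective (g := Finsupp.linearCombination (MonoidAlgebra R Γ) id)
      fun q => LinearMap.congr_fun hs q
  apply hs_inj
  rw [map_zero]
  ext q g
  have h0 : (∑ i, B.repr x i * s (f (B i)) q).coeff g = 0 := by rw [← hsf, hx]; simp
  rw [hsf, MonoidAlgebra.coeff_sum, Finsupp.finsetSum_apply]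
  rw [MonoidAlgebra.coeff_sum, Finsupp.finsetSum_apply] at h0
  have key : ∀ i, (B.repr (restrict B C x) i * s (f (B i)) q).coeff g =
      if g ∈ C * T then (B.repr x i * s (f (B i)) q).coeff g else 0 := fun i =>
    coeff_restrict_mul _ _ _ (groupSupport B x) C T (coeff_repr_restrict B C x i)
      (fun γ hγ => (mem_groupSupport B).2 ⟨i, Finsupp.mem_support_iff.1 hγ⟩) (hT i q)
      (fun c hc a ha h => hC c hc a ha (Finset.mem_insert_of_mem h)) g
  simp_rw [key]
  split_ifs
  · exact h0
  · simp

end Components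

section Bound

/-! ### Uniform bounds for fillings -/

open scoped Pointwise Classical

variable {R Γ L M Q : Type*} [Ring R] [Group Γ]
  [AddCommGroup L] [Module (MonoidAlgebra R Γ) L]
  [AddCommGroup M] [Module (MonoidAlgebra R Γ) M]
  [AddCommGroup Q] [Module (MonoidAlgebra R Γ) Q]
  {r r' : ℕ} (B : Module.Basis (Fin r) (MonoidAlgebra R Γ) M)
  (B' : Module.Basis (Fin r') (MonoidAlgebra R Γ) L)

/-- An `R`-linear map is bounded, independently of the coefficients, on chains with support in a
fixed finite set. -/
theorem exists_supportSize_le (h : M →+ L)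
    (hh : ∀ (a : R) x, h ((MonoidAlgebra.single 1 a : MonoidAlgebra R Γ) • x) =
      (MonoidAlgebra.single 1 a : MonoidAlgebra R Γ) • h x) (W : Finset Γ) :
    ∃ K, ∀ x, groupSupport B x ⊆ W → supportSize B' (h x) ≤ K := by
  refine ⟨∑ i, ∑ γ ∈ W,
    supportSize B' (h ((MonoidAlgebra.single γ 1 : MonoidAlgebra R Γ) • B i)), fun x hx => ?_⟩
  rw [eq_sum_of_groupSupport_subset B x W hx]
  simp_rw [map_sum, hh]
  refine (supportSize_sum_le B' _ _).trans (Finset.sum_le_sum fun i _ => ?_)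
  refine (supportSize_sum_le B' _ _).trans (Finset.sum_le_sum fun γ _ => ?_)
  exact supportSize_single_smul_le B' _ _ _

/-- If `ker f` admits an `R`-linear filling along `g`, then the elements of `ker f` of size at most
`l` have fillings of bounded size. -/
theorem exists_filling_bound [Module.Projective (MonoidAlgebra R Γ) Q]
    (g : L →ₗ[MonoidAlgebra R Γ] M) (f : M →ₗ[MonoidAlgebra R Γ] Q) (h : M →+ L)
    (hh : ∀ (a : R) x, h ((MonoidAlgebra.single 1 a : MonoidAlgebra R Γ) • x) =
      (MonoidAlgebra.single 1 a : MonoidAlgebra R Γ) • h x)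
    (hfill : ∀ z, f z = 0 → g (h z) = z) (l : ℕ) :
    ∃ K, ∀ z, f z = 0 → supportSize B z ≤ l → ∃ b, g b = z ∧ supportSize B' b ≤ K := by
  obtain ⟨E, hE, hsplit⟩ := exists_adjacency B f
  obtain ⟨K, hK⟩ := exists_supportSize_le B B' h hh (E ^ l)
  -- The number of components is at most `l`, and each has a filling of size at most `K`.
  suffices H : ∀ k ≤ l, ∀ z, f z = 0 → (groupSupport B z).card ≤ k →
      ∃ b, g b = z ∧ supportSize B' b ≤ k * K from
    ⟨l * K, fun z hz hl => H l le_rfl z hz ((card_groupSupport_le B z).trans hl)⟩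
  intro k
  induction k with
  | zero =>
    intro _ z _ hk
    rw [Nat.le_zero, Finset.card_eq_zero] at hk
    exact ⟨0, by rw [map_zero, eq_zero_of_groupSupport_eq_empty B hk],
      (supportSize_zero B').le.trans (Nat.zero_le _)⟩
  | succ k ih =>
    intro hkl z hz hk
    rcases (groupSupport B z).eq_empty_or_nonempty with hemp | ⟨γ, hγ⟩
    · exact ⟨0, by rw [map_zero, eq_zero_of_groupSupport_eq_empty B hemp],
        (supportSize_zero B').le.trans (Nat.zero_le _)⟩
    obtain ⟨C, hCA, hγC, hCE, hC⟩ := exists_closed_subset_near hE hγ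
    have hzC := hsplit z C hz hC
    obtain ⟨b, hb, hbK⟩ := ih (by omega) (z - restrict B C z) (by rw [map_sub, hz, hzC, sub_zero])
      (by
        have h1 := Finset.card_le_card (groupSupport_sub_restrict_subset B C z)
        have h2 : (groupSupport B z \ C).card < (groupSupport B z).card :=
          Finset.card_lt_card (Finset.sdiff_ssubset hCA ⟨γ, hγC⟩)
        omega)
    -- Translate the component at `γ` to the identity and fill it there.
    let w := (MonoidAlgebra.single γ⁻¹ 1 : MonoidAlgebra R Γ) • restrict B C z
    have hw : groupSupport B w ⊆ E ^ l := by
      refine (groupSupport_single_smul_subset B γ⁻¹ _ C (groupSupport_restrict_subset B C z)).trans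
        ?_
      rw [Finset.smul_finset_subset_iff, inv_inv]
      exact hCE.trans (Finset.smul_finset_subset_smul_finset
        (Finset.pow_subset_pow_right hE (hk.trans hkl)))
    have hgw : g (h w) = w := hfill w (by rw [map_smul, hzC, smul_zero])
    refine ⟨(MonoidAlgebra.single γ 1 : MonoidAlgebra R Γ) • h w + b, ?_, ?_⟩
    · rw [map_add, map_smul, hgw, hb, smul_smul, MonoidAlgebra.single_mul_single,
        mul_inv_cancel, one_mul, ← MonoidAlgebra.one_def, one_smul, add_sub_cancel]
    · have h1 := supportSize_add_le B' ((MonoidAlgebra.single γ 1 : MonoidAlgebra R Γ) • h w) b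
      have h2 := supportSize_single_smul_le B' γ (1 : R) (h w)
      have h3 := hK w hw
      rw [Nat.succ_mul]
      omega

end Bound

theorem fillingFunction_discreteNorm_lt_top {R : Type u} {Γ : Type v} [Ring R] [Group Γ] {m : ℕ}
    (P : AdmissibleResolution R Γ (m + 1)) (l : ℝ≥0) :
    fillingFunction (discreteNorm R) P l < ∞ := by
  obtain ⟨h, hh, hfill⟩ := exists_linear_filling P.res m
  have := P.res.projective m
  obtain ⟨K, hK⟩ := exists_filling_bound P.basis P.basisSucc
    (P.res.complex.d (m + 2) (m + 1)).hom (P.res.complex.d (m + 1) m).hom h hh hfill ⌊l⌋₊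
  refine lt_of_le_of_lt (b := (K : ℝ≥0∞)) ?_ (ENNReal.natCast_lt_top K)
  refine iSup_le fun c => iSup_le fun hc => iSup_le fun hcl => ?_
  rw [l1Norm_discreteNorm] at hcl
  obtain ⟨b, hb, hbK⟩ := hK c hc (Nat.le_floor hcl)
  refine (iInf₂_le b hb).trans ?_
  rw [l1Norm_discreteNorm]
  exact_mod_cast hbK

end HomologicalFilling

theorem mainTheorem2 (R : Type u) (Γ : Type v) [Ring R] [Nontrivial R] [Group Γ]
    (n : ℕ) (hn : 2 ≤ n) (hΓ : HomologicalFilling.IsTypeFP R Γ n)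
    (P : HomologicalFilling.AdmissibleResolution R Γ (n - 1)) (l : ℝ≥0) :
    HomologicalFilling.dFV n P l < ∞ := by
  obtain ⟨m, rfl⟩ := Nat.exists_eq_add_of_le' hn
  exact HomologicalFilling.fillingFunction_discreteNorm_lt_top (m := m) P l
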